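/- For a positive integer $n$ and a field $F$, let $J_n=I_n+N_n\in F^{n\times n}$, where $N_n$ has entry $1$ in the positions $(i,i+1)$, $1\le i<n$, and $0$ elsewhere. For integers $1\le r\le s$ and a prime $p$, let $\lambda(r,s,p)=(\lambda_1\ge\cdots\ge\lambda_r>0)$ be the partition such that $J_r\otimes J_s$ is similar to $J_{\lambda_1}\oplus\cdots\oplus J_{\lambda_r}$ over fields of characteristic $p$, and let $\pi(r,s,p)$ be the map $n\mapsto (r+1-n)+s-\lambda_n$ on $\{1,\dots,r\}$. For $1\le i\le j\le r$ let $\mathrm{Rev}(i,j)$ be the permutation of $\{1,\dots,r\}$ with $n\mapsto i+j-n$ for $i\le n\le j$ and $n\mapsto n$ otherwise. Proposition. Let $r,s,s',m$ be positive integers with $r\le s$, and let $p$ be a prime. Then $\lambda(r,s,p)$ is well defined (for every field $F$ of characteristic $p$ there is exactly one such partition, with exactly $r$ nonzero parts, and it does not depend on $F$), $\pi(r,s,p)$ is a permutation of $\{1,\dots,r\}$, and: (a) If $s\le p\le r+s-2$, then $\pi(r,s,p)=\mathrm{Rev}(1,r+s-p)$. (b) If $r\le p^m$, then $\pi(r,s,p)=\pi(r,s+kp^m,p)$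 for each integer $k\ge 0$. (c) If $r\le\min\{s,s',p^m\}$ and $s+s'\equiv 0\pmod{p^m}$, then $\pi(r,s',p)=\pi(r,s,p)^{\mathrm{Rev}(1,r)}=\mathrm{Rev}(1,r)^{-1}\,\pi(r,s,p)\,\mathrm{Rev}(1,r)$. -/

import Mathlib

open scoped Kronecker

/-- The unipotent Jordan block `J_n = I_n + N_n`, where `N_n` has entry `1` in the positions
`(i, i + 1)` and `0` elsewhere. -/
def jordanBlock (F : Type*) [CommRing F] (n : ℕ) : Matrix (Fin n) (Fin n) F :=
  Matrix.of fun i j => if i = j ∨ (i : ℕ) + 1 = (j : ℕ) then 1 else 0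

/-- `μ = (μ_1 ≥ ⋯ ≥ μ_r > 0)` is the Jordan partition of `J_r ⊗ J_s` over `F`: the Kronecker
product `J_r ⊗ J_s` is similar (through mutually inverse matrices `P` and `Q`) to the block
diagonal matrix `J_{μ_1} ⊕ ⋯ ⊕ J_{μ_r}`. The part `μ_n` is `μ ⟨n - 1, _⟩`. -/
def IsJordanPartition (F : Type*) [CommRing F] (r s : ℕ) (μ : Fin r → ℕ) : Prop :=
  Antitone μ ∧ (∀ i, 0 < μ i) ∧
    ∃ (P : Matrix (Fin r × Fin s) (Σ i : Fin r, Fin (μ i)) F)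
      (Q : Matrix (Σ i : Fin r, Fin (μ i)) (Fin r × Fin s) F),
      P * Q = 1 ∧ Q * P = 1 ∧
        jordanBlock F r ⊗ₖ jordanBlock F s =
          P * Matrix.blockDiagonal' (fun i : Fin r => jordanBlock F (μ i)) * Q

/-- The Jordan partition `λ(r, s, p)`, taken over the prime field `ZMod p`. -/
noncomputable def jordanPartition (r s p : ℕ) : Fin r → ℕ :=
  Classical.epsilon fun μ => IsJordanPartition (ZMod p) r s μ

/-- `σ` is the permutation `n ↦ (r + 1 - n) + s - λ_n` of `{1, …, r}`, where
`λ = λ(r, s, p)`. The point `n` of `{1, …, r}` is the element `⟨n - 1, _⟩` of `Fin r`. -/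
def IsNormanPerm (r s p : ℕ) (σ : Equiv.Perm (Fin r)) : Prop :=
  ∀ n : Fin r, ((σ n : ℕ) : ℤ) + 1 =
    ((r : ℤ) + 1 - (((n : ℕ) : ℤ) + 1)) + (s : ℤ) - (jordanPartition r s p n : ℤ)

/-- The Norman permutation `π(r, s, p)`. -/
noncomputable def normanPerm (r s p : ℕ) : Equiv.Perm (Fin r) :=
  Classical.epsilon fun σ => IsNormanPerm r s p σ

/-- The map underlying `Rev(i, j)`: the point `n = a + 1` of `{1, …, r}` goes to `i + j - n` if
`i ≤ n ≤ j`, and is fixed otherwise (for `1 ≤ i ≤ j ≤ r`; other `i`, `j` give the identity). -/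
def revFun (r i j : ℕ) (a : Fin r) : Fin r :=
  if h : (1 ≤ i ∧ j ≤ r) ∧ i ≤ (a : ℕ) + 1 ∧ (a : ℕ) + 1 ≤ j then
    ⟨i + j - ((a : ℕ) + 1) - 1, by omega⟩
  else a

theorem revFun_involutive (r i j : ℕ) : Function.Involutive (revFun r i j) := by
  intro a
  by_cases h : (1 ≤ i ∧ j ≤ r) ∧ i ≤ (a : ℕ) + 1 ∧ (a : ℕ) + 1 ≤ j
  · have h1 : revFun r i j a = ⟨i + j - ((a : ℕ) + 1) - 1, by omega⟩ := by
      simp only [revFun, dif_pos h]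
    rw [h1]
    unfold revFun
    rw [dif_pos (by dsimp only; omega)]
    ext
    dsimp only
    omega
  · have h1 : revFun r i j a = a := by simp only [revFun, dif_neg h]
    rw [h1, h1]

/-- The reversal permutation `Rev(i, j)` of `{1, …, r}`. -/
def rev (r i j : ℕ) : Equiv.Perm (Fin r) :=
  (revFun_involutive r i j).toPerm

/-!
Write `q = p ^ m`. The nilpotent part `z = J_r ⊗ J_s - 1` is multiplication by
`(1 + x) * (1 + y) - 1` on `A = F[x] / (x ^ r) ⊗ F[y] / (y ^ s)`. Since `z - x = (1 + x) * y`, the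
elements `x` and `z` satisfy `x ^ r = 0` and `(z - x) ^ s = 0`, and `A` is the graded algebra with
generators `x`, `z` of degree one and these two relations. The Jordan type of `z` can thus be read
off from homogeneous elements of `A`, that is, after putting `z = 1`, from polynomials in one
variable and their degrees.

For `i < r` let `e(i)` be the least degree of a polynomial `u` such that `(1 - X) ^ s * u` is
congruent modulo `X ^ r` to a polynomial `v` of degree exactly `i` (`minDegree`). Subtracting
multiples of minimizers shows that `e` is a permutation of `{0, …, r - 1}`; it is the relative
position of the degree filtration of `F[X] / (X ^ r)` and its image under `(1 - X) ^ s`.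
Homogenizing the congruence gives `z ^ (s + e(i) - i) * V_i = 0` for the homogenization `V_i` of
`v`. Modulo `z`, the `V_i` are nonzero multiples of the powers of `x`, so the strings
`V_i, z * V_i, z ^ 2 * V_i, …` span `A`; as their lengths `s + e(i) - i` add up to `r * s`, they
form a Jordan basis. Multiplying the congruence by `X` gives `e(i + 1) ≤ e(i) + 1`, so these
lengths are already in decreasing order: `λ_{i+1} = s + e(i) - i`
(`isJordanPartition_minDegreePerm`). The parts are unique because the ranks of the powers of the
nilpotent part determine them (`IsJordanPartition.unique`). It follows that `π(r, s, p)` is `e`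
followed by the reversal (`normanPerm_apply`), and everything reduces to statements about `e`.

* For `r ≤ q` one has `(1 - X) ^ q ≡ 1` modulo `X ^ r`, so `e` depends only on `s` modulo `q`
  (`minDegree_add_mul`).
* If `q` divides `s + s'`, the powers `(1 - X) ^ s` and `(1 - X) ^ s'` are inverse modulo `X ^ r`,
  so `e` and the corresponding `e'` are inverse permutations. The values `e'(i) - i` are then the
  negatives of the values `e(i) - i` in some order, and since both sequences are antitone,
  `e'` is the conjugate of `e` by the reversal (`minDegreePerm_eq_rev`).
* If `r ≤ s ≤ p`, replace `(1 - X) ^ s` by the inverse of `(1 - X) ^ (p - s)`. Polynomials `v` of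
  degree below `r + s - p` are multiplied by `(1 - X) ^ (p - s)` without truncation, and for the
  others a Padé-type bound, obtained by differentiating, forces `e(i) = r - 1 - i`
  (`minDegreePerm_eq_of_le_prime`).
-/

section

open Polynomial Module

/-! ### The relative position of a power of `1 - X` and the degree filtration -/

/-- The least degree of a polynomial `u` such that `(1 - X) ^ s * u` is congruent modulo `X ^ r`
to a polynomial of degree exactly `i`. For `i < r` these numbers describe the relative position
of the degree filtration of `F[X] / (X ^ r)` and its image under multiplication by
`(1 - X) ^ s`. -/
noncomputable def minDegree (F : Type*) [Field F] (r s i : ℕ) : ℕ :=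
  sInf {j | ∃ u v : F[X], X ^ r ∣ (1 - X) ^ s * u - v ∧ u.natDegree = j ∧ v.degree = (i : ℕ)}

section MinDegree

variable {F : Type*} [Field F] {r s i j : ℕ}

theorem minDegree_le {u v : F[X]} (h : X ^ r ∣ (1 - X) ^ s * u - v) (hv : v.degree = (i : ℕ)) :
    minDegree F r s i ≤ u.natDegree :=
  Nat.sInf_le ⟨u, v, h, rfl, hv⟩

theorem isCoprime_X_pow_one_sub_X_pow (r s : ℕ) : IsCoprime (X ^ r : F[X]) ((1 - X) ^ s) := by
  apply IsCoprime.pow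
  exact ⟨1, 1, by ring⟩

theorem exists_minDegree (F : Type*) [Field F] (r s i : ℕ) :
    ∃ u v : F[X], X ^ r ∣ (1 - X) ^ s * u - v ∧ u.natDegree = minDegree F r s i ∧
      v.degree = (i : ℕ) := by
  have hne : {j | ∃ u v : F[X], X ^ r ∣ (1 - X) ^ s * u - v ∧ u.natDegree = j ∧
      v.degree = (i : ℕ)}.Nonempty := by
    obtain ⟨a, b, hab⟩ := isCoprime_X_pow_one_sub_X_pow (F := F) r s
    refine ⟨_, b * X ^ i, X ^ i, ⟨-a * X ^ i, ?_⟩, rfl, by simp⟩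
    linear_combination X ^ i * hab
  exact Nat.sInf_mem hne

theorem eq_zero_of_X_pow_dvd {v : F[X]} (h : X ^ r ∣ v) (hv : v.degree < r) : v = 0 :=
  Polynomial.eq_zero_of_dvd_of_degree_lt h (by simpa using hv)

theorem minDegree_lt (hi : i < r) : minDegree F r s i < r := by
  obtain ⟨u, v, h, -, hv⟩ := exists_minDegree F r s i
  have hm : (X ^ r : F[X]).Monic := monic_X_pow r
  have h' : X ^ r ∣ (1 - X) ^ s * (u %ₘ X ^ r) - v := by
    have := (dvd_mul_right (X ^ r : F[X]) (u /ₘ X ^ r)).mul_left ((1 - X) ^ s)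
    have h2 := dvd_sub h this
    have e := modByMonic_add_div u (X ^ r : F[X])
    convert h2 using 1
    linear_combination (1 - X) ^ s * e
  refine (minDegree_le h' hv).trans_lt ?_
  have := natDegree_modByMonic_lt u hm (by
    intro h1
    have := congrArg natDegree h1
    simp at this
    omega)
  simpa using this

/-- Multiplication by `X` preserves congruences modulo `X ^ r` and shifts degrees by one. -/
theorem minDegree_succ_le : minDegree F r s (i + 1) ≤ minDegree F r s i + 1 := by
  obtain ⟨u, v, h, hu, hv⟩ := exists_minDegree F r s i
  have h' : X ^ r ∣ (1 - X) ^ s * (X * u) - X * v := by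
    convert h.mul_left X using 1
    ring
  refine (minDegree_le (i := i + 1) h' (by simp [hv, add_comm])).trans ?_
  refine natDegree_mul_le.trans ?_
  simp [hu, add_comm]

/-- If two indices had the same value, subtracting a multiple of one minimizer from the other
would lower the degree of the latter. -/
theorem minDegree_injOn : Set.InjOn (minDegree F r s) (Set.Iio r) := by
  have key : ∀ i k : ℕ, i < k → k < r → minDegree F r s i ≠ minDegree F r s k := by
    intro i k hik hk heq
    obtain ⟨u, v, h, hu, hv⟩ := exists_minDegree F r s i
    obtain ⟨u', v', h', hu', hv'⟩ := exists_minDegree F r s k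
    have hu0 : u ≠ 0 := by
      rintro rfl
      have : v = 0 := eq_zero_of_X_pow_dvd (r := r) (by simpa using h) (by
        rw [hv]; exact_mod_cast hik.trans hk)
      simp [this] at hv
    set c := u'.leadingCoeff / u.leadingCoeff with hc
    have hd : (v' - C c * v).degree = (k : ℕ) := by
      rw [degree_sub_eq_left_of_degree_lt, hv']
      rw [← smul_eq_C_mul]
      refine (degree_smul_le c v).trans_lt ?_
      rw [hv, hv']
      exact_mod_cast hik
    have hdvd : X ^ r ∣ (1 - X) ^ s * (u' - C c * u) - (v' - C c * v) := by
      convert dvd_sub h' (h.mul_left (C c)) using 1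
      ring
    have hle := minDegree_le hdvd hd
    have hw0 : u' - C c * u ≠ 0 := by
      intro h0
      rw [h0] at hdvd
      have : v' - C c * v = 0 := eq_zero_of_X_pow_dvd (r := r) (by
        rwa [mul_zero, zero_sub, dvd_neg] at hdvd) (by
        rw [hd]; exact_mod_cast hk)
      simp [this] at hd
    have hu'0 : u' ≠ 0 := by
      rintro rfl
      simp [hc] at hw0
    have hc0 : c ≠ 0 := div_ne_zero (leadingCoeff_ne_zero.2 hu'0) (leadingCoeff_ne_zero.2 hu0)
    have hlt : (u' - C c * u).degree < u'.degree := by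
      apply degree_sub_lt_left
      · rw [degree_C_mul hc0, degree_eq_natDegree hu'0, degree_eq_natDegree hu0, hu, hu', heq]
      · exact hu'0
      · rw [leadingCoeff_mul, leadingCoeff_C, hc, div_mul_cancel₀ _ (leadingCoeff_ne_zero.2 hu0)]
    have := natDegree_lt_natDegree hw0 hlt
    omega
  intro i hi k hk heq
  rcases lt_trichotomy i k with h | h | h
  · exact absurd heq (key i k h hk)
  · exact h
  · exact absurd heq.symm (key k i h hi)

/-- The permutation of `{0, …, r - 1}` given by `minDegree`. -/
noncomputable def minDegreePerm (F : Type*) [Field F] (r s : ℕ) : Equiv.Perm (Fin r) :=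
  Equiv.ofBijective (fun i => ⟨minDegree F r s i, minDegree_lt i.2⟩) <|
    Finite.injective_iff_bijective.1 fun i k h =>
      Fin.ext (minDegree_injOn i.2 k.2 (by simpa using h))

theorem minDegreePerm_val (i : Fin r) : (minDegreePerm F r s i : ℕ) = minDegree F r s i := rfl

/-- In other words, the string lengths `s + e i - i`, with `e` this permutation, are weakly
decreasing. -/
theorem antitone_minDegreePerm_sub :
    Antitone fun i : Fin r => (minDegreePerm F r s i : ℤ) - (i : ℕ) := by
  have : Antitone fun i : ℕ => (minDegree F r s i : ℤ) - i := by
    apply antitone_nat_of_succ_le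
    intro n
    have := minDegree_succ_le (F := F) (r := r) (s := s) (i := n)
    push_cast
    omega
  intro i k hik
  exact this hik

/-- An injective self-map of `Fin n` that never increases is the identity. -/
theorem Fin.eq_self_of_injective_of_le {n : ℕ} {f : Fin n → Fin n} (hf : Function.Injective f)
    (h : ∀ i, f i ≤ i) (i : Fin n) : f i = i := by
  induction i using WellFoundedLT.induction with
  | ind i ih =>
    refine le_antisymm (h i) (not_lt.1 fun hlt => ?_)
    exact hlt.ne (hf (ih _ hlt))

variable {p : ℕ} [Fact p.Prime] [CharP F p]

theorem X_pow_dvd_one_sub_X_pow_sub_one {m : ℕ} (h : r ≤ p ^ m) (k : ℕ) :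
    (X ^ r : F[X]) ∣ (1 - X) ^ (k * p ^ m) - 1 := by
  have h1 : ((1 - X) ^ p ^ m : F[X]) = 1 - X ^ p ^ m := by
    rw [sub_pow_char_pow, one_pow]
  rw [mul_comm, pow_mul, h1]
  refine ((pow_dvd_pow X h).trans ?_).trans (sub_one_dvd_pow_sub_one (1 - X ^ p ^ m : F[X]) k)
  exact ⟨-1, by ring⟩

theorem minDegree_add_mul {m : ℕ} (h : r ≤ p ^ m) (k : ℕ) :
    minDegree F r (s + k * p ^ m) i = minDegree F r s i := by
  have key : ∀ u v : F[X], X ^ r ∣ (1 - X) ^ (s + k * p ^ m) * u - v ↔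
      X ^ r ∣ (1 - X) ^ s * u - v := by
    intro u v
    have h1 := (X_pow_dvd_one_sub_X_pow_sub_one (F := F) h k).mul_right ((1 - X) ^ s * u)
    rw [show (1 - X) ^ (s + k * p ^ m) * u - v =
      ((1 - X) ^ (k * p ^ m) - 1) * ((1 - X) ^ s * u) + ((1 - X) ^ s * u - v) by ring,
      dvd_add_right h1]
  simp only [minDegree, key]

/-- When `p ^ m` divides `s + s'`, multiplication by `(1 - X) ^ s'` inverts multiplication by
`(1 - X) ^ s`. -/
theorem dvd_one_sub_X_pow_mul_sub {m s' : ℕ} (h : r ≤ p ^ m) (hs : p ^ m ∣ s + s') {u v : F[X]}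
    (hd : X ^ r ∣ (1 - X) ^ s * u - v) : X ^ r ∣ (1 - X) ^ s' * v - u := by
  obtain ⟨k, hk⟩ := hs
  have h1 := (X_pow_dvd_one_sub_X_pow_sub_one (F := F) h k).mul_right u
  rw [mul_comm k, ← hk] at h1
  convert dvd_sub h1 (hd.mul_left ((1 - X) ^ s')) using 1
  ring

/-- Exchanging the roles of `u` and `v` in the congruence shows that the composition never
increases. -/
theorem minDegreePerm_minDegreePerm {m s' : ℕ} (h : r ≤ p ^ m) (hs : p ^ m ∣ s + s')
    (i : Fin r) : minDegreePerm F r s' (minDegreePerm F r s i) = i := by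
  apply Fin.eq_self_of_injective_of_le (f := fun i => minDegreePerm F r s' (minDegreePerm F r s i))
  · exact (minDegreePerm F r s').injective.comp (minDegreePerm F r s).injective
  intro i
  obtain ⟨u, v, hd, hu, hv⟩ := exists_minDegree F r s i
  have hu0 : u ≠ 0 := by
    rintro rfl
    have : v = 0 := eq_zero_of_X_pow_dvd (r := r) (by simpa using hd) (by
      rw [hv]; exact_mod_cast i.2)
    simp [this] at hv
  rw [Fin.le_def, minDegreePerm_val, minDegreePerm_val]
  refine (minDegree_le (dvd_one_sub_X_pow_mul_sub h hs hd) ?_).trans_eq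
    (natDegree_eq_of_degree_eq_some hv)
  rw [degree_eq_natDegree hu0, hu]

/-- Both sides have antitone differences with the identity, and these differences are
rearrangements of one another. -/
theorem minDegreePerm_eq_rev {m s' : ℕ} (h : r ≤ p ^ m) (hs : p ^ m ∣ s + s')
    (i : Fin r) : minDegreePerm F r s' i = (minDegreePerm F r s i.rev).rev := by
  set e := minDegreePerm F r s with he
  set e' := minDegreePerm F r s' with he'
  let d : Fin r → ℤ := fun i => (e' i : ℤ) - (i : ℕ)
  have hde : ∀ i, d (e i) = (i : ℕ) - (e i : ℤ) := fun i => by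
    simp only [d, he', he, minDegreePerm_minDegreePerm h hs]
  have h1 : Monotone (d ∘ e) := by
    intro a b hab
    have := antitone_minDegreePerm_sub (F := F) (s := s) hab
    simp only [Function.comp, hde]
    simp only [← he] at this
    omega
  have h2 : Monotone (d ∘ Fin.revPerm) := by
    intro a b hab
    exact antitone_minDegreePerm_sub (F := F) (s := s') (Fin.rev_le_rev.2 hab)
  have h3 := congrFun (Tuple.unique_monotone h1 h2) i.rev
  simp only [Function.comp, hde, Fin.revPerm_apply, Fin.rev_rev, d] at h3
  ext
  rw [Fin.val_rev] at h3 ⊢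
  omega

/-! ### The case `s ≤ p` -/

/-- Each differentiation of `(1 - X) ^ n * v` lowers the power of `1 - X` by one and does not
raise the degree of the cofactor. -/
theorem exists_iterate_derivative_one_sub_X_pow_mul (t k : ℕ) (v : F[X]) :
    ∃ h : F[X], h.natDegree ≤ v.natDegree ∧
      derivative^[k] ((1 - X) ^ (t + k) * v) = (1 - X) ^ t * h := by
  induction k generalizing v with
  | zero => exact ⟨v, le_rfl, rfl⟩
  | succ k ih =>
    obtain ⟨h, hh, e⟩ := ih ((1 - X) * derivative v - C ((t + k + 1 : ℕ) : F) * v)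
    refine ⟨h, hh.trans ?_, ?_⟩
    · refine (natDegree_sub_le _ _).trans (max_le ?_ (natDegree_C_mul_le _ _))
      by_cases hv : v.natDegree = 0
      · rw [derivative_of_natDegree_zero hv, mul_zero]
        simp
      · refine natDegree_mul_le.trans ?_
        have h1 : ((1 : F[X]) - X).natDegree ≤ 1 := by
          refine (natDegree_sub_le _ _).trans ?_
          simp
        have h2 := natDegree_derivative_lt hv
        omega
    · rw [← e, Function.iterate_succ_apply]
      congr 1
      rw [← add_assoc, derivative_mul, derivative_pow_succ]
      simp only [derivative_sub, derivative_one, derivative_X, map_natCast]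
      simp only [map_add, map_one, map_natCast, Nat.cast_add, Nat.cast_one]
      ring

/-- Below degree `p`, the `k`-th derivative kills only polynomials of degree less than `k`. -/
theorem natDegree_lt_of_iterate_derivative_eq_zero {f : F[X]} {k : ℕ} (hk : 0 < k)
    (hf : f.natDegree < p) (h : derivative^[k] f = 0) : f.natDegree < k := by
  by_contra! hlt
  have hc : (derivative^[k] f).coeff (f.natDegree - k) = 0 := by rw [h, coeff_zero]
  rw [coeff_iterate_derivative, Nat.sub_add_cancel hlt, nsmul_eq_mul, mul_eq_zero] at hc
  rcases hc with hc | hc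
  · rw [CharP.cast_eq_zero_iff F p] at hc
    have h1 : p ∣ f.natDegree.factorial :=
      hc.trans (Nat.factorial_mul_descFactorial hlt ▸ dvd_mul_left _ _)
    exact absurd ((Fact.out : p.Prime).dvd_factorial.1 h1) (not_le.2 hf)
  · rw [coeff_natDegree, leadingCoeff_eq_zero] at hc
    rw [hc, natDegree_zero] at hlt
    omega

theorem X_pow_dvd_derivative {f : F[X]} {n : ℕ} (h : X ^ n ∣ f) : X ^ (n - 1) ∣ derivative f := by
  obtain ⟨g, rfl⟩ := h
  rw [derivative_mul]
  refine dvd_add ?_ ((pow_dvd_pow X (Nat.sub_le n 1)).mul_right _)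
  rw [derivative_X_pow]
  exact (dvd_mul_left _ _).mul_right _

theorem X_pow_dvd_iterate_derivative {f : F[X]} {n : ℕ} (h : X ^ n ∣ f) (k : ℕ) :
    X ^ (n - k) ∣ derivative^[k] f := by
  induction k with
  | zero => exact h
  | succ k ih =>
    rw [Function.iterate_succ_apply', ← Nat.sub_sub]
    exact X_pow_dvd_derivative ih

/-- A Padé-type bound: in characteristic `p ≥ r + t`, the product `(1 - X) ^ t * v` cannot agree to
order `r` with a polynomial `u` of degree below `t` if `deg u + deg v < r - 1`. Differentiating
`deg u + 1` times removes `u`, and leaves a multiple of a power of `1 - X` that is too small to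
vanish to the remaining order. -/
theorem le_natDegree_add_natDegree_of_X_pow_dvd {t : ℕ} (hp : r + t ≤ p) {u v : F[X]}
    (hv0 : v ≠ 0) (hv : v.natDegree < r) (hu : u.natDegree < t)
    (h : X ^ r ∣ (1 - X) ^ t * v - u) : r ≤ u.natDegree + v.natDegree + 1 := by
  by_contra! hlt
  set j := u.natDegree
  have hX : ((1 : F[X]) - X).natDegree = 1 := by
    rw [← natDegree_neg, neg_sub, ← C_1, natDegree_X_sub_C]
  have hX0 : ((1 : F[X]) - X) ≠ 0 := fun h0 => by simp [h0] at hX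
  obtain ⟨w, hw, e⟩ := exists_iterate_derivative_one_sub_X_pow_mul (F := F) (t - (j + 1)) (j + 1) v
  rw [Nat.sub_add_cancel hu] at e
  have h1 := X_pow_dvd_iterate_derivative h (j + 1)
  rw [iterate_derivative_sub, iterate_derivative_eq_zero (Nat.lt_succ_self j), sub_zero, e] at h1
  have h2 := (isCoprime_X_pow_one_sub_X_pow _ _).dvd_of_dvd_mul_left h1
  have h3 : w = 0 := eq_zero_of_X_pow_dvd h2
    (degree_le_natDegree.trans_lt (by exact_mod_cast (by omega)))
  have hd : ((1 - X) ^ t * v).natDegree = t + v.natDegree := by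
    rw [natDegree_mul (pow_ne_zero _ hX0) hv0, natDegree_pow, hX, mul_one]
  have h4 := natDegree_lt_of_iterate_derivative_eq_zero (p := p) (Nat.succ_pos j)
    (by rw [hd]; omega) (by rw [e, h3, mul_zero])
  omega

/-- The congruence is inverted to `(1 - X) ^ (p - s) * v ≡ u`. If `v` has degree below
`r - (p - s)`, both sides have degree below `r` and are equal; otherwise the Padé-type bound gives
`r - 1 ≤ e i + i`, and bijectivity turns this into an equality. -/
theorem minDegreePerm_eq_of_le_prime (hrs : r ≤ s) (hs : s ≤ p) (i : Fin r) :
    (minDegreePerm F r s i : ℕ) =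
      if i + (p - s) < r then i + (p - s) else r - 1 - i := by
  obtain ⟨t, ht⟩ : ∃ t, t = p - s := ⟨_, rfl⟩
  rw [← ht]
  set e := minDegreePerm F r s with he
  have hrel : ∀ i : Fin r, ∃ u v : F[X], X ^ r ∣ (1 - X) ^ t * v - u ∧ u.natDegree = e i ∧
      v.natDegree = i ∧ v ≠ 0 := by
    intro i
    obtain ⟨u, v, h, hu, hv⟩ := exists_minDegree F r s i
    refine ⟨u, v, dvd_one_sub_X_pow_mul_sub (p := p) (m := 1) ?_ ?_ h, hu,
      natDegree_eq_of_degree_eq_some hv, ?_⟩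
    · rw [pow_one]; omega
    · rw [pow_one, ht, Nat.add_sub_cancel' hs]
    · rintro rfl
      simp at hv
  have hX : ((1 : F[X]) - X).natDegree = 1 := by
    rw [← natDegree_neg, neg_sub, ← C_1, natDegree_X_sub_C]
  have hX0 : ((1 : F[X]) - X) ≠ 0 := fun h0 => by simp [h0] at hX
  have h1 : ∀ i : Fin r, (i : ℕ) + t < r → (e i : ℕ) = i + t := by
    intro i hi
    obtain ⟨u, v, h, hu, hv, hv0⟩ := hrel i
    have hd : ((1 - X) ^ t * v).natDegree = t + i := by
      rw [natDegree_mul (pow_ne_zero _ hX0) hv0, natDegree_pow, hX, mul_one, hv]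
    have h0 : (1 - X) ^ t * v - u = 0 := by
      refine eq_zero_of_X_pow_dvd h (degree_le_natDegree.trans_lt ?_)
      have h2 := natDegree_sub_le ((1 - X) ^ t * v) u
      rw [hd, hu] at h2
      have := (e i).2
      exact_mod_cast h2.trans_lt (max_lt (by omega) this)
    rw [← hu, ← sub_eq_zero.1 h0, hd, add_comm]
  have h2 : ∀ i : Fin r, ¬ (i : ℕ) + t < r → (e i : ℕ) < t := by
    intro i hi
    by_contra! hlt
    have hr := (e i).2
    -- the values `≥ t` are already taken by the indices below `r - t`
    have h3 := h1 ⟨(e i : ℕ) - t, by omega⟩ (by dsimp only; omega)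
    have h4 := congrArg Fin.val (e.injective (a₁ := ⟨(e i : ℕ) - t, by omega⟩) (a₂ := i)
      (Fin.ext (by rw [h3]; dsimp only; omega)))
    dsimp only at h4
    omega
  have h3 : ∀ i : Fin r, ¬ (i : ℕ) + t < r → r ≤ e i + i + 1 := by
    intro i hi
    obtain ⟨u, v, h, hu, hv, hv0⟩ := hrel i
    have := le_natDegree_add_natDegree_of_X_pow_dvd (p := p) (t := t) (by omega) hv0
      (hv ▸ i.2) (hu ▸ h2 i hi) h
    rwa [hu, hv] at this
  -- hence the two ranges of indices are permuted separately, with equality in `h3`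
  have hf := Fin.eq_self_of_injective_of_le
    (f := fun i : Fin r => if (i : ℕ) + t < r then i else (e i).rev) (by
      intro i k hik
      dsimp only at hik
      split_ifs at hik with hi hk hk
      · exact hik
      · have := congrArg Fin.val hik
        have := h2 k hk
        rw [Fin.val_rev] at *
        omega
      · have := congrArg Fin.val hik
        have := h2 i hi
        rw [Fin.val_rev] at *
        omega
      · exact e.injective (Fin.rev_injective hik)) (by
      intro i
      split_ifs with hi
      · exact le_rfl
      · have := h3 i hi
        rw [Fin.le_def, Fin.val_rev]
        omega) i
  split_ifs with hi
  · exact h1 i hi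
  · rw [if_neg hi] at hf
    have := congrArg Fin.val hf
    rw [Fin.val_rev] at this
    have := (e i).2
    omega

end MinDegree

/-! ### Uniqueness of Jordan partitions -/

section Uniqueness

/-- The `n × n` matrix with entry `1` in the positions `(i, i + k)` and `0` elsewhere. -/
def shiftMatrix (F : Type*) [CommRing F] (n k : ℕ) : Matrix (Fin n) (Fin n) F :=
  Matrix.of fun i j => if (i : ℕ) + k = j then 1 else 0

theorem jordanBlock_sub_one_pow (F : Type*) [CommRing F] (n k : ℕ) :
    (jordanBlock F n - 1) ^ k = shiftMatrix F n k := by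
  have h1 : jordanBlock F n - 1 = shiftMatrix F n 1 := by
    ext i j
    by_cases h : i = j
    · subst h
      simp [jordanBlock, shiftMatrix]
    · simp [jordanBlock, shiftMatrix, h]
  induction k with
  | zero =>
    ext i j
    simp [shiftMatrix, Matrix.one_apply, Fin.ext_iff]
  | succ k ih =>
    rw [pow_succ', ih, h1]
    ext i j
    simp only [shiftMatrix, Matrix.mul_apply, Matrix.of_apply, ite_mul, one_mul, zero_mul]
    by_cases hi : (i : ℕ) + 1 < n
    · rw [Finset.sum_eq_single ⟨(i : ℕ) + 1, hi⟩]
      · simp [add_assoc, add_comm 1 k]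
      · intro b _ hb
        rw [if_neg]
        rintro h
        exact hb (Fin.ext h.symm)
      · simp
    · rw [Finset.sum_eq_zero, if_neg]
      · have := j.2
        omega
      · intro b _
        rw [if_neg]
        have := b.2
        omega

/-- The rank of the `k`-th power of the nilpotent matrix with Jordan block sizes `μ_i` is
`∑ max (μ_i - k) 0`; the truncated subtraction computes the maximum. -/
theorem rank_blockDiagonal'_jordanBlock_sub_one_pow (F : Type*) [Field F] {r : ℕ} (μ : Fin r → ℕ)
    (k : ℕ) :
    ((Matrix.blockDiagonal' (fun i : Fin r => jordanBlock F (μ i)) - 1) ^ k).rank =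
      ∑ i, (μ i - k) := by
  have hB : (Matrix.blockDiagonal' (fun i : Fin r => jordanBlock F (μ i)) - 1) ^ k =
      Matrix.blockDiagonal' fun i : Fin r => shiftMatrix F (μ i) k := by
    have h1 : Matrix.blockDiagonal' (fun i : Fin r => jordanBlock F (μ i)) - 1 =
        Matrix.blockDiagonal' fun i => jordanBlock F (μ i) - 1 := by
      rw [← Matrix.blockDiagonal'_one, ← Matrix.blockDiagonal'_sub]
      rfl
    rw [h1, ← Matrix.blockDiagonal'_pow]
    congr 1
    funext i
    exact jordanBlock_sub_one_pow F (μ i) k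
  rw [hB, Matrix.rank_eq_finrank_span_cols]
  -- the nonzero columns are distinct standard basis vectors
  have hcol : ∀ (i : Fin r) (b : Fin (μ i)) (h : k ≤ b),
      (Matrix.blockDiagonal' fun i : Fin r => shiftMatrix F (μ i) k).col ⟨i, b⟩ =
        Pi.single ⟨i, ⟨b - k, by omega⟩⟩ 1 := by
    intro i b h
    funext ⟨i', a⟩
    rw [Matrix.col_apply, Matrix.blockDiagonal'_apply]
    by_cases hi : i' = i
    · subst hi
      rw [dif_pos rfl, Pi.single_apply]
      simp only [cast_eq, shiftMatrix, Matrix.of_apply, Sigma.mk.injEq, heq_eq_eq, true_and,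
        Fin.ext_iff]
      congr 1
      exact propext (by omega)
    · rw [dif_neg hi, Pi.single_eq_of_ne]
      exact fun h => hi (congrArg Sigma.fst h)
  have hcol0 : ∀ (i : Fin r) (b : Fin (μ i)) (h : ¬ k ≤ b),
      (Matrix.blockDiagonal' fun i : Fin r => shiftMatrix F (μ i) k).col ⟨i, b⟩ = 0 := by
    intro i b h
    funext ⟨i', a⟩
    rw [Matrix.col_apply, Matrix.blockDiagonal'_apply]
    by_cases hi : i' = i
    · subst hi
      rw [dif_pos rfl]
      simp only [cast_eq, shiftMatrix, Matrix.of_apply, Pi.zero_apply]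
      rw [if_neg (by omega)]
    · rw [dif_neg hi]
      rfl
  let w : (Σ i : Fin r, Fin (μ i - k)) → (Σ i : Fin r, Fin (μ i)) :=
    fun q => ⟨q.1, ⟨q.2, by omega⟩⟩
  have hw : Function.Injective w := by
    rintro ⟨i, a⟩ ⟨i', a'⟩ h
    simp only [w, Sigma.mk.injEq] at h
    obtain ⟨rfl, h⟩ := h
    simpa [Fin.ext_iff] using h
  have hli : LinearIndependent F fun q => (Pi.single (w q) 1 : (Σ i : Fin r, Fin (μ i)) → F) := by
    have := (Pi.basisFun F (Σ i : Fin r, Fin (μ i))).linearIndependent.comp w hw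
    convert this using 2 with q
    simp
  have hspan : Submodule.span F
      (Set.range (Matrix.blockDiagonal' fun i : Fin r => shiftMatrix F (μ i) k).col) =
      Submodule.span F
        (Set.range fun q => (Pi.single (w q) 1 : (Σ i : Fin r, Fin (μ i)) → F)) := by
    apply le_antisymm
    · rw [Submodule.span_le]
      rintro _ ⟨⟨i, b⟩, rfl⟩
      by_cases h : k ≤ b
      · rw [hcol i b h]
        exact Submodule.subset_span ⟨⟨i, ⟨b - k, by omega⟩⟩, rfl⟩
      · rw [hcol0 i b h]
        exact Submodule.zero_mem _
    · rw [Submodule.span_le]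
      rintro _ ⟨⟨i, b⟩, rfl⟩
      refine Submodule.subset_span ⟨⟨i, ⟨b + k, by omega⟩⟩, ?_⟩
      rw [hcol i ⟨b + k, by omega⟩ (by simp)]
      simp [w]
  rw [hspan, finrank_span_eq_card hli]
  simp

/-- A weakly decreasing sequence is determined by the sums of the positive parts of
`μ_i - k`: their differences count the `i` with `k < μ_i`. -/
theorem Antitone.eq_of_sum_sub_eq {r : ℕ} {μ ν : Fin r → ℕ} (hμ : Antitone μ) (hν : Antitone ν)
    (h : ∀ k, ∑ i, (μ i - k) = ∑ i, (ν i - k)) : μ = ν := by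
  have hsum : ∀ (κ : Fin r → ℕ) (k : ℕ),
      ∑ i, (κ i - k) = ∑ i, (κ i - (k + 1)) + (Finset.univ.filter fun i => k < κ i).card := by
    intro κ k
    rw [Finset.card_filter, ← Finset.sum_add_distrib]
    refine Finset.sum_congr rfl fun i _ => ?_
    split_ifs <;> omega
  have hcard : ∀ k, (Finset.univ.filter fun i => k < μ i).card =
      (Finset.univ.filter fun i => k < ν i).card := by
    intro k
    have h1 := hsum μ k
    have h2 := hsum ν k
    rw [h k, h (k + 1)] at h1
    omega
  have hlt : ∀ κ : Fin r → ℕ, Antitone κ → ∀ k i, k < κ i ↔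
      (i : ℕ) < (Finset.univ.filter fun i => k < κ i).card := by
    intro κ hκ k i
    constructor
    · intro hi
      have : Finset.Iic i ⊆ Finset.univ.filter fun i => k < κ i := by
        intro a ha
        rw [Finset.mem_filter]
        exact ⟨Finset.mem_univ _, hi.trans_le (hκ (Finset.mem_Iic.1 ha))⟩
      have := Finset.card_le_card this
      rw [Fin.card_Iic] at this
      omega
    · intro hi
      by_contra! hk
      have : (Finset.univ.filter fun i => k < κ i) ⊆ Finset.Iio i := by
        intro a ha
        rw [Finset.mem_Iio]
        by_contra! hia
        have := hκ hia
        have := (Finset.mem_filter.1 ha).2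
        omega
      have := Finset.card_le_card this
      rw [Fin.card_Iio] at this
      omega
  funext i
  refine eq_of_forall_lt_iff fun k => ?_
  rw [hlt μ hμ, hlt ν hν, hcard]

theorem rank_blockDiagonal'_le_of_similar {F : Type*} [Field F] {r s : ℕ} {μ ν : Fin r → ℕ}
    {P : Matrix (Fin r × Fin s) (Σ i, Fin (μ i)) F} {Q : Matrix (Σ i, Fin (μ i)) (Fin r × Fin s) F}
    {P' : Matrix (Fin r × Fin s) (Σ i, Fin (ν i)) F}
    {Q' : Matrix (Σ i, Fin (ν i)) (Fin r × Fin s) F}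
    {B : Matrix (Σ i, Fin (μ i)) (Σ i, Fin (μ i)) F}
    {C : Matrix (Σ i, Fin (ν i)) (Σ i, Fin (ν i)) F}
    (h0 : P * Q = 1) (h1 : Q * P = 1) (h2 : P' * Q' = 1) (h3 : Q' * P' = 1)
    (h : P * B * Q = P' * C * Q') (k : ℕ) :
    ((B - 1) ^ k).rank ≤ ((C - 1) ^ k).rank := by
  have hB : B - 1 = Q * P' * (C - 1) * (Q' * P) := by
    calc B - 1 = Q * P * B * (Q * P) - Q * P := by rw [h1]; simp
      _ = Q * (P * B * Q) * P - Q * (P' * Q') * P := by rw [h2]; simp [Matrix.mul_assoc]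
      _ = _ := by rw [h]; simp [Matrix.mul_assoc, Matrix.mul_sub, Matrix.sub_mul]
  have hk : (B - 1) ^ k = Q * P' * (C - 1) ^ k * (Q' * P) := by
    induction k with
    | zero =>
      rw [pow_zero, pow_zero, Matrix.mul_one, Matrix.mul_assoc, ← Matrix.mul_assoc P', h2,
        Matrix.one_mul, h1]
    | succ k ih =>
      rw [pow_succ, ih, hB, pow_succ]
      calc Q * P' * (C - 1) ^ k * (Q' * P) * (Q * P' * (C - 1) * (Q' * P))
          = Q * P' * (C - 1) ^ k * (Q' * (P * Q) * P') * (C - 1) * (Q' * P) := by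
            simp only [Matrix.mul_assoc]
        _ = _ := by
            have h4 : Q' * (P * Q) * P' = 1 := by rw [h0, Matrix.mul_one, h3]
            rw [h4, Matrix.mul_one, Matrix.mul_assoc (Q * P') _ (C - 1)]
  rw [hk]
  exact (Matrix.rank_mul_le_left _ _).trans (Matrix.rank_mul_le_right _ _)

theorem IsJordanPartition.unique {F : Type*} [Field F] {r s : ℕ} {μ ν : Fin r → ℕ}
    (hμ : IsJordanPartition F r s μ) (hν : IsJordanPartition F r s ν) : μ = ν := by
  obtain ⟨aμ, -, P, Q, h1, h2, h⟩ := hμ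
  obtain ⟨aν, -, P', Q', h1', h2', h'⟩ := hν
  refine aμ.eq_of_sum_sub_eq aν fun k => ?_
  rw [← rank_blockDiagonal'_jordanBlock_sub_one_pow F μ,
    ← rank_blockDiagonal'_jordanBlock_sub_one_pow F ν]
  exact le_antisymm
    (rank_blockDiagonal'_le_of_similar h1 h2 h1' h2' (h.symm.trans h') k)
    (rank_blockDiagonal'_le_of_similar h1' h2' h1 h2 (h'.symm.trans h) k)

theorem IsJordanPartition.map {F K : Type*} [CommRing F] [CommRing K] (φ : F →+* K) {r s : ℕ}
    {μ : Fin r → ℕ} (h : IsJordanPartition F r s μ) : IsJordanPartition K r s μ := by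
  obtain ⟨h1, h2, P, Q, hPQ, hQP, h⟩ := h
  have hJ : ∀ n, (jordanBlock F n).map φ = jordanBlock K n := by
    intro n
    ext i j
    simp [jordanBlock, apply_ite φ]
  refine ⟨h1, h2, P.map φ, Q.map φ, ?_, ?_, ?_⟩
  · rw [← Matrix.map_mul, hPQ, Matrix.map_one _ φ.map_zero φ.map_one]
  · rw [← Matrix.map_mul, hQP, Matrix.map_one _ φ.map_zero φ.map_one]
  · have h3 := congrArg (fun M => M.map φ) h
    simp only [Matrix.map_mul] at h3
    rw [Matrix.blockDiagonal'_map _ _ φ.map_zero] at h3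
    simp only [hJ] at h3
    rw [← h3]
    ext ⟨a, b⟩ ⟨c, d⟩
    simp [← hJ]

end Uniqueness

/-! ### Existence of Jordan partitions -/

section Existence

theorem Polynomial.homogenize_add_right {R : Type*} [CommSemiring R] {v : R[X]} {i : ℕ}
    (hv : v.natDegree ≤ i) (d : ℕ) :
    v.homogenize (i + d) = v.homogenize i * MvPolynomial.X 1 ^ d := by
  have := homogenize_mul v 1 hv (n := d) (by simp)
  rwa [mul_one, homogenize_one] at this

section Strings

variable {F A : Type*} [Field F] [CommRing A] [Algebra F A] {r s : ℕ} {x z : A}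

/-- Homogenizing a congruence `(1 - X) ^ s * u ≡ v` modulo `X ^ r` gives
`(z - x) ^ s * U - z ^ (s + j - i) * V ∈ (x ^ r)` for the homogenizations `U` and `V`. -/
theorem pow_mul_aeval_homogenize_eq_zero (hx : x ^ r = 0) (hzx : (z - x) ^ s = 0) (hrs : r ≤ s)
    {u v : F[X]} (h : X ^ r ∣ (1 - X) ^ s * u - v) {i j : ℕ} (hu : u.natDegree ≤ j)
    (hv : v.natDegree ≤ i) (hij : i ≤ s + j) :
    z ^ (s + j - i) * MvPolynomial.aeval ![x, z] (v.homogenize i) = 0 := by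
  obtain ⟨w, hw⟩ := h
  have hX : ((1 : F[X]) - X).natDegree ≤ 1 := by
    refine (natDegree_sub_le _ _).trans ?_
    simp
  have hXs : ((1 - X : F[X]) ^ s).natDegree ≤ s :=
    natDegree_pow_le.trans (by nlinarith)
  have hXh : ∀ n, MvPolynomial.aeval ![x, z] (((1 - X : F[X]) ^ n).homogenize n) = (z - x) ^ n := by
    intro n
    induction n with
    | zero => simp
    | succ n ih =>
      rw [pow_succ, homogenize_mul _ _ (natDegree_pow_le.trans (by nlinarith)) hX, map_mul, ih]
      simp [pow_succ]
  have hwd : w.natDegree ≤ s + j - r := by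
    by_cases hw0 : w = 0
    · simp [hw0]
    have h1 : (X ^ r * w).natDegree = r + w.natDegree := by
      rw [natDegree_mul (pow_ne_zero _ X_ne_zero) hw0, natDegree_X_pow]
    rw [← hw] at h1
    have h2 := natDegree_sub_le ((1 - X) ^ s * u) v
    have h3 : ((1 - X) ^ s * u).natDegree ≤ s + j := natDegree_mul_le.trans (by omega)
    have := h2.trans (max_le h3 (hv.trans hij))
    omega
  have h1 := congrArg (fun f => MvPolynomial.aeval ![x, z] (f.homogenize (s + j))) hw
  rw [homogenize_sub, homogenize_mul _ _ hXs hu, map_sub, map_mul, hXh, hzx, zero_mul, zero_sub,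
    show s + j = r + (s + j - r) by omega,
    homogenize_mul (X ^ r) w (by simp) hwd, homogenize_X_pow le_rfl, map_mul, map_mul, map_pow,
    MvPolynomial.aeval_X, Matrix.cons_val_zero, hx, zero_mul, zero_mul, neg_eq_zero,
    show r + (s + j - r) = i + (s + j - i) by omega, homogenize_add_right hv] at h1
  simpa [mul_comm] using h1

/-- Modulo `z`, the homogenization of `v` in degree `i` is its leading term `v_i * x ^ i`. -/
theorem exists_aeval_homogenize_eq (x z : A) {v : F[X]} {i : ℕ} (hv : v.natDegree ≤ i) :
    ∃ b : A, MvPolynomial.aeval ![x, z] (v.homogenize i) = v.coeff i • x ^ i + z * b := by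
  cases i with
  | zero =>
    rw [eq_C_of_natDegree_le_zero hv]
    exact ⟨0, by simp [Algebra.smul_def]⟩
  | succ i =>
    have hw : (v - C (v.coeff (i + 1)) * X ^ (i + 1)).natDegree ≤ i := by
      rw [natDegree_le_iff_coeff_eq_zero]
      intro N hN
      rw [coeff_sub, coeff_C_mul_X_pow]
      split_ifs with h
      · rw [h, sub_self]
      · rw [coeff_eq_zero_of_natDegree_lt (by omega), sub_zero]
    have h := homogenize_add_right hw 1
    rw [homogenize_sub, sub_eq_iff_eq_add, homogenize_C_mul, homogenize_X_pow le_rfl] at h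
    refine ⟨MvPolynomial.aeval ![x, z]
      ((v - C (v.coeff (i + 1)) * X ^ (i + 1)).homogenize i), ?_⟩
    rw [h]
    simp [Algebra.smul_def]
    ring

/-- Nakayama's lemma for a nilpotent element `z` and a subspace stable under `z`. -/
theorem Submodule.eq_top_of_forall_exists_add_mul {S : Submodule F A} (hz : IsNilpotent z)
    (hS : ∀ a ∈ S, z * a ∈ S) (h : ∀ a, ∃ c ∈ S, ∃ b, a = c + z * b) : S = ⊤ := by
  have key : ∀ n : ℕ, ∀ a, ∃ c ∈ S, ∃ b, a = c + z ^ n * b := by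
    intro n
    induction n with
    | zero => exact fun a => ⟨0, S.zero_mem, a, by simp⟩
    | succ n ih =>
      intro a
      obtain ⟨c, hc, b, rfl⟩ := h a
      obtain ⟨c', hc', b', rfl⟩ := ih b
      exact ⟨c + z * c', S.add_mem hc (hS _ hc'), b', by ring⟩
  obtain ⟨n, hn⟩ := hz
  rw [eq_top_iff]
  intro a _
  obtain ⟨c, hc, b, rfl⟩ := key n a
  simpa [hn] using hc

/-- The strings `z ^ k * g_i`, where `g_i` is homogeneous of degree `i` in `x` and `z` and not
divisible by `z`, span the algebra, because modulo `z` the `g_i` are nonzero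
multiples of the powers of `x`. -/
theorem span_strings_eq_top (hx : x ^ r = 0) (hz : IsNilpotent z)
    (hgen : ∀ a : A, ∃ (f : F[X]) (b : A), a = aeval x f + z * b)
    {v : Fin r → F[X]} (hv : ∀ i, (v i).degree = (i : ℕ)) {l : Fin r → ℕ}
    (h : ∀ i, z ^ l i * MvPolynomial.aeval ![x, z] ((v i).homogenize i) = 0) :
    Submodule.span F (Set.range fun q : Σ i, Fin (l i) =>
      z ^ (l q.1 - 1 - q.2) * MvPolynomial.aeval ![x, z] ((v q.1).homogenize q.1)) = ⊤ := by
  set S := Submodule.span F (Set.range fun q : Σ i, Fin (l i) =>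
      z ^ (l q.1 - 1 - q.2) * MvPolynomial.aeval ![x, z] ((v q.1).homogenize q.1)) with hSdef
  have hmem : ∀ (i : Fin r) (k : ℕ),
      z ^ k * MvPolynomial.aeval ![x, z] ((v i).homogenize i) ∈ S := by
    intro i k
    by_cases hk : k < l i
    · refine Submodule.subset_span ⟨⟨i, ⟨l i - 1 - k, by omega⟩⟩, ?_⟩
      dsimp only
      rw [show l i - 1 - (l i - 1 - k) = k by omega]
    · rw [← Nat.sub_add_cancel (not_lt.1 hk), pow_add, mul_assoc, h, mul_zero]
      exact S.zero_mem
  have hS : ∀ a ∈ S, z * a ∈ S := by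
    intro a ha
    have : S ≤ S.comap (LinearMap.mulLeft F z) := by
      rw [hSdef, Submodule.span_le]
      rintro _ ⟨q, rfl⟩
      rw [← hSdef, SetLike.mem_coe, Submodule.mem_comap, LinearMap.mulLeft_apply, ← mul_assoc,
        ← pow_succ']
      exact hmem _ _
    exact this ha
  refine Submodule.eq_top_of_forall_exists_add_mul hz hS ?_
  have hT : ∀ a : A, a ∈ S ⊔ LinearMap.range (LinearMap.mulLeft F z) := by
    intro a
    have hpow : ∀ n : ℕ, x ^ n ∈ S ⊔ LinearMap.range (LinearMap.mulLeft F z) := by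
      intro n
      by_cases hn : n < r
      · obtain ⟨b, hb⟩ := exists_aeval_homogenize_eq x z (i := n)
          (natDegree_le_of_degree_le (hv ⟨n, hn⟩).le)
        have hc : (v ⟨n, hn⟩).coeff n ≠ 0 := coeff_ne_zero_of_eq_degree (hv ⟨n, hn⟩)
        have h1 : x ^ n = ((v ⟨n, hn⟩).coeff n)⁻¹ •
            (MvPolynomial.aeval ![x, z] ((v ⟨n, hn⟩).homogenize n) - z * b) := by
          rw [hb, add_sub_cancel_right, inv_smul_smul₀ hc]
        rw [h1]
        refine Submodule.smul_mem _ _ (Submodule.sub_mem _ ?_ ?_)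
        · exact Submodule.mem_sup_left (by simpa using hmem ⟨n, hn⟩ 0)
        · exact Submodule.mem_sup_right ⟨b, rfl⟩
      · rw [← Nat.sub_add_cancel (not_lt.1 hn), pow_add, hx, mul_zero]
        exact Submodule.zero_mem _
    obtain ⟨f, b, rfl⟩ := hgen a
    refine Submodule.add_mem _ ?_ (Submodule.mem_sup_right ⟨b, rfl⟩)
    rw [aeval_eq_sum_range]
    exact Submodule.sum_mem _ fun n _ => Submodule.smul_mem _ _ (hpow n)
  intro a
  obtain ⟨c, hc, _, ⟨b, rfl⟩, h1⟩ := Submodule.mem_sup.1 (hT a)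
  exact ⟨c, hc, b, h1.symm⟩

end Strings

section Matrices

variable {F A : Type*} [Field F] [AddCommGroup A] [Module F A]

theorem toMatrix_eq_jordanBlock {n : ℕ} (b : Basis (Fin n) F A) (L : A →ₗ[F] A)
    (h : ∀ j : Fin n, L (b j) = b j + if h : 0 < (j : ℕ) then b ⟨j - 1, by omega⟩ else 0) :
    LinearMap.toMatrix b b L = jordanBlock F n := by
  ext i j
  rw [LinearMap.toMatrix_apply, h]
  split_ifs with hj
  · simp only [map_add, Basis.repr_self, Finsupp.add_apply, Finsupp.single_apply, jordanBlock,
      Matrix.of_apply, Fin.ext_iff]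
    split_ifs <;> first | omega | simp
  · simp only [Basis.repr_self, add_zero, Finsupp.single_apply, jordanBlock,
      Matrix.of_apply, Fin.ext_iff]
    split_ifs <;> first | omega | rfl

/-- The basis vectors of each string are listed from its last nonzero vector to its generator, so
that the entries `1` of the nilpotent part lie above the diagonal. -/
theorem toMatrix_eq_blockDiagonal' {r : ℕ} {l : Fin r → ℕ} (b : Basis (Σ i, Fin (l i)) F A)
    (L : A →ₗ[F] A)
    (h : ∀ (i : Fin r) (j : Fin (l i)),
      L (b ⟨i, j⟩) = b ⟨i, j⟩ + if h : 0 < (j : ℕ) then b ⟨i, ⟨j - 1, by omega⟩⟩ else 0) :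
    LinearMap.toMatrix b b L = Matrix.blockDiagonal' fun i => jordanBlock F (l i) := by
  ext ⟨i', i⟩ ⟨j', j⟩
  rw [LinearMap.toMatrix_apply, h, Matrix.blockDiagonal'_apply]
  by_cases hij : i' = j'
  · subst hij
    rw [dif_pos rfl]
    split_ifs with hj
    · simp only [map_add, Basis.repr_self, Finsupp.add_apply, Finsupp.single_apply, jordanBlock,
        Matrix.of_apply, Fin.ext_iff, Sigma.mk.injEq, heq_eq_eq, true_and, cast_eq]
      split_ifs <;> first | omega | simp
    · simp only [Basis.repr_self, add_zero, Finsupp.single_apply, jordanBlock,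
        Matrix.of_apply, Fin.ext_iff, Sigma.mk.injEq, heq_eq_eq, true_and, cast_eq]
      split_ifs <;> first | omega | rfl
  · have hij' : j' ≠ i' := Ne.symm hij
    rw [dif_neg hij]
    split_ifs with hj
    · simp [hij']
    · simp [hij']

end Matrices

/-- The algebra `F[X] / (X ^ n)`. -/
abbrev TruncatedPolynomial (F : Type*) [Field F] (n : ℕ) : Type _ := AdjoinRoot (X ^ n : F[X])

namespace TruncatedPolynomial

variable (F : Type*) [Field F] (n : ℕ)

/-- The class of the variable. -/
noncomputable abbrev gen : TruncatedPolynomial F n := AdjoinRoot.root (X ^ n : F[X])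

theorem gen_pow : gen F n ^ n = 0 := by
  have := AdjoinRoot.mk_self (f := (X ^ n : F[X]))
  rwa [map_pow, AdjoinRoot.mk_X] at this

/-- The basis `gen ^ (n - 1), …, gen, 1`, in which multiplication by `1 + gen` is a Jordan block. -/
noncomputable def revPowBasis : Basis (Fin n) F (TruncatedPolynomial F n) :=
  (AdjoinRoot.powerBasis' (monic_X_pow (R := F) n)).basis.reindex
    ((finCongr (by simp)).trans Fin.revPerm)

theorem revPowBasis_apply (j : Fin n) : revPowBasis F n j = gen F n ^ (n - 1 - j) := by
  rw [revPowBasis, Basis.reindex_apply, PowerBasis.basis_eq_pow]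
  simp [Fin.val_rev]
  congr 1
  omega

theorem toMatrix_mulLeft_one_add_gen :
    LinearMap.toMatrix (revPowBasis F n) (revPowBasis F n) (LinearMap.mulLeft F (1 + gen F n)) =
      jordanBlock F n := by
  apply toMatrix_eq_jordanBlock
  intro j
  simp only [LinearMap.mulLeft_apply, revPowBasis_apply, add_mul, one_mul, ← pow_succ']
  congr 1
  split_ifs with h
  · congr 1
    omega
  · rw [show n - 1 - (j : ℕ) + 1 = n by omega, gen_pow]

end TruncatedPolynomial

open TruncatedPolynomial TensorProduct

/-- The strings generated by the homogenizations of the polynomials `v` in the definition of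
`minDegree` form a Jordan basis of `F[x] / (x ^ r) ⊗ F[y] / (y ^ s)` for multiplication by
`(1 + x) * (1 + y)`. -/
theorem isJordanPartition_minDegreePerm (F : Type*) [Field F] {r s : ℕ} (hrs : r ≤ s) :
    IsJordanPartition F r s fun i => s + minDegreePerm F r s i - i := by
  set e := minDegreePerm F r s with he
  set l : Fin r → ℕ := fun i => s + e i - i with hl
  have hlpos : ∀ i, 0 < l i := fun i => by
    have := i.2
    simp only [hl]
    omega
  have hanti : Antitone l := by
    intro a b hab
    have := antitone_minDegreePerm_sub (F := F) (s := s) hab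
    have := a.2
    have := b.2
    simp only [hl]
    simp only [← he] at *
    omega
  have hsum : ∑ i, l i = r * s := by
    have h1 : ∑ i, l i + ∑ i : Fin r, (i : ℕ) = ∑ i : Fin r, s + ∑ i, (e i : ℕ) := by
      rw [← Finset.sum_add_distrib, ← Finset.sum_add_distrib]
      refine Finset.sum_congr rfl fun i _ => ?_
      have := i.2
      simp only [hl]
      omega
    rw [Equiv.sum_comp e fun i => (i : ℕ), add_left_inj] at h1
    simpa using h1
  let A := TruncatedPolynomial F r ⊗[F] TruncatedPolynomial F s
  let x : A := gen F r ⊗ₜ 1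
  let y : A := 1 ⊗ₜ gen F s
  let z : A := (1 + x) * (1 + y) - 1
  have hx : x ^ r = 0 :=
    (Algebra.TensorProduct.tmul_pow _ _ r).trans (by rw [gen_pow, zero_tmul])
  have hy : y ^ s = 0 :=
    (Algebra.TensorProduct.tmul_pow _ _ s).trans (by rw [gen_pow, tmul_zero])
  have hzxy : z - x = (1 + x) * y := by simp only [z]; ring
  have hzx : (z - x) ^ s = 0 := by rw [hzxy, mul_pow, hy, mul_zero]
  have hz : IsNilpotent z := by
    have h1 : IsNilpotent (z - x) := ⟨s, hzx⟩
    have h2 : IsNilpotent x := ⟨r, hx⟩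
    simpa using (Commute.all _ _).isNilpotent_add h1 h2
  have hgen : ∀ a : A, ∃ (f : F[X]) (b : A), a = aeval x f + z * b := by
    -- modulo `z` the element `y` is a polynomial in `x`, as `1 + x` is invertible in `F[x]`
    obtain ⟨c, hc⟩ : ∃ c : F[X], (1 + x) * aeval x c = 1 := by
      refine ⟨∑ k ∈ Finset.range r, (-X) ^ k, ?_⟩
      have h1 := mul_neg_geom_sum (-x) r
      rw [neg_pow, hx, mul_zero, sub_zero, sub_neg_eq_add] at h1
      simpa using h1
    have hyz : ∃ b, y = aeval x (-X * c) + z * b := by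
      refine ⟨aeval x c, ?_⟩
      simp only [map_mul, map_neg, aeval_X, z]
      linear_combination (-y) * hc
    intro a
    induction a using TensorProduct.induction_on with
    | zero => exact ⟨0, 0, by simp⟩
    | add a b ha hb =>
      obtain ⟨f, a', ha⟩ := ha
      obtain ⟨g, b', hb⟩ := hb
      refine ⟨f + g, a' + b', ?_⟩
      rw [ha, hb, map_add]
      ring
    | tmul a b =>
      obtain ⟨f, rfl⟩ := AdjoinRoot.mk_surjective a
      obtain ⟨g, rfl⟩ := AdjoinRoot.mk_surjective b
      have hf : aeval x f = AdjoinRoot.mk _ f ⊗ₜ[F] (1 : TruncatedPolynomial F s) := by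
        rw [← AdjoinRoot.aeval_eq]
        exact aeval_algHom_apply
          (Algebra.TensorProduct.includeLeft : TruncatedPolynomial F r →ₐ[F] A) _ f
      have hg : aeval y g = (1 : TruncatedPolynomial F r) ⊗ₜ[F] AdjoinRoot.mk _ g := by
        rw [← AdjoinRoot.aeval_eq]
        exact aeval_algHom_apply
          (Algebra.TensorProduct.includeRight : TruncatedPolynomial F s →ₐ[F] A) _ g
      have h1 : AdjoinRoot.mk (X ^ r : F[X]) f ⊗ₜ[F] AdjoinRoot.mk (X ^ s : F[X]) g =
          aeval x f * aeval y g := by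
        rw [hf, hg, Algebra.TensorProduct.tmul_mul_tmul, mul_one, one_mul]
      obtain ⟨b, hb⟩ := hyz
      have h2 := sub_dvd_eval_sub y (aeval x (-X * c)) (g.map (algebraMap F A))
      rw [eval_map_algebraMap, eval_map_algebraMap, ← aeval_comp] at h2
      obtain ⟨d, hd⟩ := h2
      refine ⟨f * g.comp (-X * c), aeval x f * b * d, ?_⟩
      rw [h1, map_mul]
      linear_combination aeval x f * hd + aeval x f * d * hb
  choose u v huv hu hv using fun i : Fin r => exists_minDegree F r s i
  have hg : ∀ i, z ^ l i * MvPolynomial.aeval ![x, z] ((v i).homogenize i) = 0 := by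
    intro i
    refine pow_mul_aeval_homogenize_eq_zero hx hzx hrs (huv i) (hu i).le
      (natDegree_le_of_degree_le (hv i).le) ?_
    have := i.2
    omega
  let β : Basis (Fin r × Fin s) F A := (revPowBasis F r).tensorProduct (revPowBasis F s)
  have hspan := span_strings_eq_top hx hz hgen hv hg
  let γ : Basis (Σ i, Fin (l i)) F A := basisOfTopLeSpanOfCardEqFinrank _ hspan.ge (by
    rw [Module.finrank_eq_card_basis β, Fintype.card_sigma]
    simpa using hsum)
  have hγ : ∀ q, γ q =
      z ^ (l q.1 - 1 - q.2) * MvPolynomial.aeval ![x, z] ((v q.1).homogenize q.1) := by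
    intro q
    simp only [γ, coe_basisOfTopLeSpanOfCardEqFinrank]
  have hβ : LinearMap.toMatrix β β (LinearMap.mulLeft F (1 + z)) =
      jordanBlock F r ⊗ₖ jordanBlock F s := by
    rw [← toMatrix_mulLeft_one_add_gen, ← toMatrix_mulLeft_one_add_gen,
      ← TensorProduct.toMatrix_map]
    congr 1
    ext a b
    have hx1 : 1 + x = (1 + gen F r) ⊗ₜ[F] (1 : TruncatedPolynomial F s) :=
      (add_tmul _ _ _).symm
    have hy1 : 1 + y = (1 : TruncatedPolynomial F r) ⊗ₜ[F] (1 + gen F s) :=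
      (tmul_add _ _ _).symm
    have hz1 : 1 + z = (1 + gen F r) ⊗ₜ[F] (1 + gen F s) := by
      rw [show 1 + z = (1 + x) * (1 + y) from add_sub_cancel _ _, hx1, hy1,
        Algebra.TensorProduct.tmul_mul_tmul, mul_one, one_mul]
    change (1 + z) * a ⊗ₜ[F] b = ((1 + gen F r) * a) ⊗ₜ[F] ((1 + gen F s) * b)
    rw [hz1, Algebra.TensorProduct.tmul_mul_tmul]
  have hγm : LinearMap.toMatrix γ γ (LinearMap.mulLeft F (1 + z)) =
      Matrix.blockDiagonal' fun i => jordanBlock F (l i) := by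
    apply toMatrix_eq_blockDiagonal'
    intro i j
    simp only [LinearMap.mulLeft_apply, hγ, add_mul, one_mul, ← mul_assoc, ← pow_succ']
    congr 1
    split_ifs with h
    · congr 2
      omega
    · rw [show l i - 1 - (j : ℕ) + 1 = l i by omega, hg]
  refine ⟨hanti, hlpos, β.toMatrix γ, γ.toMatrix β, Basis.toMatrix_mul_toMatrix_flip _ _,
    Basis.toMatrix_mul_toMatrix_flip _ _, ?_⟩
  rw [← hβ, ← hγm, basis_toMatrix_mul_linearMap_toMatrix_mul_basis_toMatrix]

end Existence

/-! ### Norman permutations -/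

section Norman

/-- A Jordan partition over `ZMod p` is one over every extension, where it is the only one. -/
theorem isJordanPartition_iff {r s p : ℕ} [Fact p.Prime] (hrs : r ≤ s) (F : Type*) [Field F]
    [CharP F p] (μ : Fin r → ℕ) :
    IsJordanPartition F r s μ ↔ μ = jordanPartition r s p := by
  have h1 : IsJordanPartition (ZMod p) r s (jordanPartition r s p) :=
    Classical.epsilon_spec ⟨_, isJordanPartition_minDegreePerm (ZMod p) hrs⟩
  have h2 := h1.map (ZMod.castHom (dvd_refl p) F)
  exact ⟨fun h => h.unique h2, fun h => h ▸ h2⟩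

theorem jordanPartition_eq {r s p : ℕ} [Fact p.Prime] (hrs : r ≤ s) (i : Fin r) :
    jordanPartition r s p i = s + minDegreePerm (ZMod p) r s i - i :=
  (congrFun ((isJordanPartition_iff hrs (ZMod p) _).1
    (isJordanPartition_minDegreePerm (ZMod p) hrs)) i).symm

theorem isNormanPerm_iff {r s p : ℕ} [Fact p.Prime] (hrs : r ≤ s) (σ : Equiv.Perm (Fin r)) :
    IsNormanPerm r s p σ ↔ σ = (minDegreePerm (ZMod p) r s).trans Fin.revPerm := by
  rw [Equiv.ext_iff]
  refine forall_congr' fun i => ?_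
  rw [jordanPartition_eq hrs, Equiv.trans_apply, Fin.revPerm_apply, Fin.ext_iff, Fin.val_rev]
  have := i.2
  have := (minDegreePerm (ZMod p) r s i).2
  omega

theorem isNormanPerm_normanPerm {r s p : ℕ} [Fact p.Prime] (hrs : r ≤ s) :
    IsNormanPerm r s p (normanPerm r s p) :=
  Classical.epsilon_spec ⟨_, (isNormanPerm_iff hrs _).2 rfl⟩

theorem normanPerm_apply {r s p : ℕ} [Fact p.Prime] (hrs : r ≤ s) (i : Fin r) :
    normanPerm r s p i = (minDegreePerm (ZMod p) r s i).rev := by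
  rw [(isNormanPerm_iff hrs _).1 (isNormanPerm_normanPerm hrs)]
  rfl

theorem val_rev_apply (r i j : ℕ) (a : Fin r) : (rev r i j a : ℕ) =
    if (1 ≤ i ∧ j ≤ r) ∧ i ≤ (a : ℕ) + 1 ∧ (a : ℕ) + 1 ≤ j then i + j - (a + 1) - 1 else a := by
  change (revFun r i j a : ℕ) = _
  unfold revFun
  split_ifs <;> rfl

theorem rev_one_self (r : ℕ) : rev r 1 r = Fin.revPerm := by
  ext a
  rw [val_rev_apply, if_pos (by omega), Fin.revPerm_apply, Fin.val_rev]
  omega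

end Norman

end

theorem mainTheorem6 (r s s' m p : ℕ) (hr : 0 < r) (hs : 0 < s) (hs' : 0 < s') (hm : 0 < m)
    (hp : p.Prime) (hrs : r ≤ s) :
    -- `λ(r, s, p)` is the unique Jordan partition over every field of characteristic `p`, and
    -- `π(r, s, p)` is the permutation given by `n ↦ (r + 1 - n) + s - λ_n`
    (∀ (F : Type*) [Field F] [CharP F p] (μ : Fin r → ℕ),
      IsJordanPartition F r s μ ↔ μ = jordanPartition r s p) ∧
    IsNormanPerm r s p (normanPerm r s p) ∧
    -- (a)
    (s ≤ p → (p : ℤ) ≤ (r : ℤ) + (s : ℤ) - 2 → normanPerm r s p = rev r 1 (r + s - p)) ∧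
    -- (b)
    (r ≤ p ^ m → ∀ k : ℕ, normanPerm r s p = normanPerm r (s + k * p ^ m) p) ∧
    -- (c)
    (r ≤ min s (min s' (p ^ m)) → s + s' ≡ 0 [MOD p ^ m] →
      normanPerm r s' p = rev r 1 r * normanPerm r s p * (rev r 1 r)⁻¹) := by
  have : Fact p.Prime := ⟨hp⟩
  refine ⟨fun F _ _ μ => isJordanPartition_iff hrs F μ, isNormanPerm_normanPerm hrs, ?_, ?_, ?_⟩
  · intro hsp _
    ext i
    have := i.2
    rw [normanPerm_apply hrs, Fin.val_rev, minDegreePerm_eq_of_le_prime hrs hsp, val_rev_apply]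
    split_ifs <;> omega
  · intro hrp k
    ext i
    rw [normanPerm_apply hrs, normanPerm_apply (hrs.trans (Nat.le_add_right _ _)), Fin.val_rev,
      Fin.val_rev, minDegreePerm_val, minDegreePerm_val, minDegree_add_mul hrp]
  · intro hrm hmod
    simp only [le_min_iff] at hrm
    ext i
    rw [rev_one_self, Equiv.Perm.mul_apply, Equiv.Perm.mul_apply, normanPerm_apply hrm.2.1,
      normanPerm_apply hrs, Fin.revPerm_apply, Fin.rev_rev,
      minDegreePerm_eq_rev hrm.2.2 ((Nat.modEq_zero_iff_dvd).1 hmod), Fin.rev_rev]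
    rfl
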